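/- **Theorem 1.1.** All topological spaces are Hausdorff. For a compact space $K$, let $\mathcal C(K)$ be the Banach space of continuous real-valued functions on $K$ with the supremum norm. Let $K_1, K_2$ be compact spaces and let $G$ be a compact topological group (not necessarily abelian or metrizable) such that both $K_1$ and $K_2$ map continuously onto $G$. Then $\mathcal C(K_1\times K_2)$ contains a complemented subspace (i.e. a linear subspace that is the range of a bounded linear projection) that is linearly isometric to $\mathcal C(G)$. More precisely, let $f_1\colon K_1\to G$ and $f_2\colon K_2\to G$ be any continuous surjections and put $$\rho\colon K_1\times K_2\to G,\qquad \rho(t_1,t_2)=f_2(t_2)^{-1}\cdot f_1(t_1).$$ Then $h\mapsto h\circ\rho$ is a linear isometry of $\mathcal C(G)$ onto a complemented subspace of $\mathcal C(K_1\times K_2)$. -/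

import Mathlib

/-!
Let `μ` be the Haar probability measure of `G` and `ρ (t₁, t₂) = f₂(t₂)⁻¹ * f₁(t₁)`. The projection
onto `{h ∘ ρ}` is a conditional expectation given `ρ`.

By the Hahn–Banach theorem there is a positive functional `Λᵢ` on `C(Kᵢ)` with
`Λᵢ (h ∘ fᵢ) = ∫ h ∂μ` (`exists_isIntegralLift`). By invariance of `μ`, the product functional `Λ` of
`Λ₁` and `Λ₂` satisfies `Λ (h ∘ ρ) = ∫ h ∂μ` (`IsIntegralLift.iteratedFunctional`). For `F` in
`C(K₁ × K₂)` the functional `h ↦ Λ (F * (h ∘ ρ))` is bounded by `‖F‖ * ∫ |h| ∂μ`, so it has a density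
bounded by `‖F‖`, and `F ↦ density` is a contraction which sends `h ∘ ρ` to `h`. What has to be
shown is that this density is continuous.

A uniform limit of functions with a continuous density has a continuous density, so by the
Stone–Weierstrass theorem it is enough to treat `F = u ⊗ v`. For those, the density is the
convolution of the densities of `f₁_*(u Λ₁)` and `f₂_*(v Λ₂)`, both of which are bounded functions,
and the convolution of two bounded functions on a compact group is continuous
(`exists_convolution`, `exists_isContinuousCondExp_tensor`).

The convolution is built without integrating over `G × G`: for continuous `b` the function
`g ↦ α (y ↦ b (y * g⁻¹))` is continuous and its supremum norm is at most a constant times the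
`L²` norm of `b`, so the construction extends to all `b` in `L²` with values in `C(G)`.
-/

open MeasureTheory Measure
open scoped InnerProductSpace

/-! ### Haar probability measure on a compact group -/

namespace MeasureTheory

section Haar

variable {G : Type*} [Group G] [TopologicalSpace G] [IsTopologicalGroup G] [CompactSpace G]
  [MeasurableSpace G] [BorelSpace G]

/-- A compact group is unimodular. -/
theorem isMulRightInvariant_of_compactSpace (μ : Measure G) [μ.IsHaarMeasure]
    [IsProbabilityMeasure μ] : μ.IsMulRightInvariant := by
  refine ⟨fun g ↦ ?_⟩
  have : IsProbabilityMeasure (map (· * g) μ) :=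
    isProbabilityMeasure_map (measurable_mul_const g).aemeasurable
  have : (map (· * g) μ).IsHaarMeasure := isHaarMeasure_map_smul μ (MulOpposite.op g)
  exact isHaarMeasure_eq_of_isProbabilityMeasure _ _

theorem isInvInvariant_of_compactSpace (μ : Measure G) [μ.IsHaarMeasure]
    [IsProbabilityMeasure μ] : μ.IsInvInvariant := by
  have := isMulRightInvariant_of_compactSpace μ
  have : IsProbabilityMeasure μ.inv :=
    isProbabilityMeasure_map measurable_inv.aemeasurable
  have : μ.inv.IsHaarMeasure := {}
  exact ⟨isHaarMeasure_eq_of_isProbabilityMeasure _ _⟩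

end Haar

end MeasureTheory

/-! ### Continuous functions on a compact space and their integrals -/

section Compact

variable {X : Type*} [TopologicalSpace X] [CompactSpace X] [MeasurableSpace X] [BorelSpace X]
  {μ : Measure X}

theorem ContinuousMap.integrable_of_compactSpace [IsFiniteMeasure μ] {E : Type*}
    [NormedAddCommGroup E] (f : C(X, E)) : Integrable f μ :=
  f.continuous.integrable_of_hasCompactSupport (HasCompactSupport.of_compactSpace f)

omit [BorelSpace X] in
theorem ContinuousMap.norm_integral_le [IsProbabilityMeasure μ] (h : C(X, ℝ)) :
    |∫ x, h x ∂μ| ≤ ‖h‖ := by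
  simpa using norm_integral_le_of_norm_le_const (μ := μ) (.of_forall h.norm_coe_le_norm)

theorem ContinuousMap.integral_abs_le_norm_toLp [IsProbabilityMeasure μ] (h : C(X, ℝ)) :
    ∫ x, |h x| ∂μ ≤ ‖ContinuousMap.toLp 2 μ ℝ h‖ := by
  have h1 : ∀ k : C(X, ℝ), ‖ContinuousMap.toLp 2 μ ℝ k‖ ^ 2 = ∫ x, k x * k x ∂μ := fun k ↦ by
    rw [← real_inner_self_eq_norm_sq, ContinuousMap.inner_toLp]; simp
  refine le_of_sq_le_sq ?_ (norm_nonneg _)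
  rw [h1]
  have h2 := ContinuousMap.inner_toLp (μ := μ) (𝕜 := ℝ) 1 |h|
  have h3 := real_inner_mul_inner_self_le (ContinuousMap.toLp 2 μ ℝ (1 : C(X, ℝ)))
    (ContinuousMap.toLp 2 μ ℝ |h|)
  rw [h2, real_inner_self_eq_norm_sq, real_inner_self_eq_norm_sq, h1, h1] at h3
  simpa [sq] using h3

/-- A continuous `p` that acts on `L¹` with bound `C` is bounded above by `C`, since the measure
charges every nonempty open set. -/
theorem ContinuousMap.le_of_integral_mul_le [IsFiniteMeasure μ] [μ.IsOpenPosMeasure]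
    {p : C(X, ℝ)} {C : ℝ}
    (hp : ∀ h : C(X, ℝ), ∫ x, p x * h x ∂μ ≤ C * ∫ x, |h x| ∂μ) (x : X) : p x ≤ C := by
  by_contra! hx
  -- Testing against the positive part `h` of `p - C` gives `∫ h² = ∫ (p - C) h ≤ 0`.
  let h : C(X, ℝ) := (p - ContinuousMap.const X C) ⊔ 0
  have h0 : ∀ y, 0 ≤ h y := fun y ↦ le_max_right _ _
  have hh : ∀ y, p y * h y - C * |h y| = (h * h) y := fun y ↦ by
    rw [abs_of_nonneg (h0 y), ← sub_mul]
    rcases le_total (p y - C) 0 with hy | hy <;> simp [h, hy]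
  have hpos : 0 < ∫ y, (h * h) y ∂μ :=
    (h * h).continuous.integral_pos_of_hasCompactSupport_nonneg_nonzero
      (HasCompactSupport.of_compactSpace _) (fun y ↦ mul_self_nonneg _)
      (x := x) (by simpa [h] using hx)
  have hi1 : Integrable (fun y ↦ p y * h y) μ := (p * h).integrable_of_compactSpace
  have hi2 : Integrable (fun y ↦ C * |h y|) μ := (|h|).integrable_of_compactSpace.const_mul C
  simp_rw [← hh] at hpos
  rw [integral_sub hi1 hi2, integral_const_mul] at hpos
  linarith [hp h]

theorem ContinuousMap.norm_le_of_abs_integral_mul_le [IsFiniteMeasure μ] [μ.IsOpenPosMeasure]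
    {p : C(X, ℝ)} {C : ℝ} (hC : 0 ≤ C)
    (hp : ∀ h : C(X, ℝ), |∫ x, p x * h x ∂μ| ≤ C * ∫ x, |h x| ∂μ) : ‖p‖ ≤ C := by
  refine (ContinuousMap.norm_le _ hC).2 fun x ↦ abs_le'.2
    ⟨le_of_integral_mul_le (fun h ↦ (le_abs_self _).trans (hp h)) x,
      le_of_integral_mul_le (p := -p) (μ := μ) (fun h ↦ ?_) x⟩
  simpa [integral_neg] using (neg_le_abs _).trans (hp h)

end Compact

/-! ### Functionals lifting integration along a continuous surjection -/

section CompSurjective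

variable {K G : Type*} [TopologicalSpace K] [CompactSpace K] [TopologicalSpace G] [CompactSpace G]

theorem ContinuousMap.norm_comp_of_surjective {f : C(K, G)} (hf : Function.Surjective f)
    (h : C(G, ℝ)) : ‖h.comp f‖ = ‖h‖ := by
  refine le_antisymm ((ContinuousMap.norm_le _ (norm_nonneg _)).2 fun x ↦ h.norm_coe_le_norm _)
    ((ContinuousMap.norm_le _ (norm_nonneg _)).2 fun y ↦ ?_)
  obtain ⟨x, rfl⟩ := hf y
  exact (h.comp f).norm_coe_le_norm x

/-- The isometric embedding `h ↦ h ∘ f` of spaces of continuous functions induced by a continuous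
surjection `f`. -/
noncomputable def ContinuousMap.compSurjective (f : C(K, G)) (hf : Function.Surjective f) :
    C(G, ℝ) →ₗᵢ[ℝ] C(K, ℝ) where
  toFun h := h.comp f
  map_add' _ _ := rfl
  map_smul' _ _ := rfl
  norm_map' := norm_comp_of_surjective hf

end CompSurjective

/-- Hahn–Banach along an isometric embedding: the norm does not increase. -/
theorem LinearIsometry.exists_extension_norm_le {E F : Type*} [NormedAddCommGroup E]
    [NormedSpace ℝ E] [NormedAddCommGroup F] [NormedSpace ℝ F] (e : E →ₗᵢ[ℝ] F) (φ : E →L[ℝ] ℝ) :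
    ∃ ψ : F →L[ℝ] ℝ, ‖ψ‖ ≤ ‖φ‖ ∧ ∀ x, ψ (e x) = φ x := by
  obtain ⟨ψ, hψ, hn⟩ := exists_extension_norm_eq (LinearMap.range e.toLinearMap)
    (φ.comp (e.equivRange.symm.toContinuousLinearEquiv : _ →L[ℝ] E))
  refine ⟨ψ, ?_, fun x ↦ ?_⟩
  · rw [hn]
    refine ContinuousLinearMap.opNorm_le_bound _ (norm_nonneg _) fun x ↦ ?_
    simpa using φ.le_opNorm (e.equivRange.symm x)
  · refine (hψ (e.equivRange x)).trans (congrArg φ ?_)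
    exact e.equivRange.symm_apply_apply x

section Lift

variable {K G : Type*} [TopologicalSpace K] [CompactSpace K] [TopologicalSpace G] [CompactSpace G]
  [MeasurableSpace G]

/-- `Λ` is a contractive functional on `C(K)` that restricts to integration against `μ` on the
functions `h ∘ f`. When `μ` is a probability measure, `Λ` is integration against a probability
measure on `K` whose pushforward under `f` is `μ`; working with `Λ` itself avoids measures on
products of compact spaces, where the Borel and the product `σ`-algebras may differ. -/
structure IsIntegralLift (μ : Measure G) (f : C(K, G)) (Λ : C(K, ℝ) →L[ℝ] ℝ) : Prop where
  norm_apply_le : ∀ u, |Λ u| ≤ ‖u‖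
  apply_comp : ∀ h : C(G, ℝ), Λ (h.comp f) = ∫ x, h x ∂μ

theorem exists_isIntegralLift [BorelSpace G] (μ : Measure G) [IsProbabilityMeasure μ] (f : C(K, G))
    (hf : Function.Surjective f) : ∃ Λ, IsIntegralLift μ f Λ := by
  let I : C(G, ℝ) →L[ℝ] ℝ := LinearMap.mkContinuous
    { toFun := fun h ↦ ∫ x, h x ∂μ
      map_add' := fun h k ↦ integral_add h.integrable_of_compactSpace k.integrable_of_compactSpace
      map_smul' := fun c h ↦ integral_const_mul c _ } 1 fun h ↦ by
        simpa using h.norm_integral_le (μ := μ)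
  obtain ⟨Λ, hn, hΛ⟩ := (ContinuousMap.compSurjective f hf).exists_extension_norm_le I
  refine ⟨Λ, fun u ↦ ?_, hΛ⟩
  have h1 : ‖Λ‖ ≤ 1 := hn.trans (LinearMap.mkContinuous_norm_le _ zero_le_one _)
  simpa using Λ.le_of_opNorm_le h1 u

namespace IsIntegralLift

variable {μ : Measure G} [IsProbabilityMeasure μ] {f : C(K, G)} {Λ : C(K, ℝ) →L[ℝ] ℝ}

omit [CompactSpace G] in
theorem apply_one (hΛ : IsIntegralLift μ f Λ) : Λ 1 = 1 := by
  simpa using hΛ.apply_comp 1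

omit [CompactSpace G] in
/-- A contractive functional that fixes the constants is positive. -/
theorem nonneg (hΛ : IsIntegralLift μ f Λ) {u : C(K, ℝ)} (hu : 0 ≤ u) : 0 ≤ Λ u := by
  have h1 : ‖‖u‖ • (1 : C(K, ℝ)) - u‖ ≤ ‖u‖ := by
    refine (ContinuousMap.norm_le _ (norm_nonneg _)).2 fun x ↦ ?_
    have h2 := (le_abs_self _).trans (u.norm_coe_le_norm x)
    have h3 : 0 ≤ u x := hu x
    rw [Real.norm_eq_abs, abs_le]
    constructor <;> simp <;> linarith
  have h2 := (le_abs_self _).trans ((hΛ.norm_apply_le _).trans h1)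
  rw [map_sub, map_smul, hΛ.apply_one] at h2
  simp at h2
  exact h2

omit [CompactSpace G] in
/-- The signed measure `f_*(u Λ)` on `G` has a density with respect to `μ`, bounded by `‖u‖`; this
is that statement in terms of functionals. -/
theorem abs_apply_mul_comp_le (hΛ : IsIntegralLift μ f Λ) (u : C(K, ℝ)) (h : C(G, ℝ)) :
    |Λ (u * h.comp f)| ≤ ‖u‖ * ∫ x, |h x| ∂μ := by
  have key : ∀ v : C(K, ℝ), ‖v‖ = ‖u‖ → Λ (v * h.comp f) ≤ ‖u‖ * ∫ x, |h x| ∂μ := by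
    intro v hv
    have h1 : 0 ≤ Λ (‖u‖ • (|h|).comp f - v * h.comp f) := hΛ.nonneg fun x ↦ by
      have h2 := v.norm_coe_le_norm x
      have h3 := le_abs_self (v x * h (f x))
      rw [abs_mul] at h3
      have h4 := mul_le_mul_of_nonneg_right h2 (abs_nonneg (h (f x)))
      rw [hv] at h4
      simp
      exact h3.trans h4
    rw [map_sub, map_smul, hΛ.apply_comp] at h1
    simp at h1
    exact h1
  refine abs_le'.2 ⟨key u rfl, ?_⟩
  simpa using key (-u) (norm_neg u)

end IsIntegralLift

end Lift

/-! ### Continuous conditional expectations -/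

section CondExp

variable {K G : Type*} [TopologicalSpace K] [CompactSpace K] [TopologicalSpace G] [CompactSpace G]
  [MeasurableSpace G] [BorelSpace G] {μ : Measure G} [IsProbabilityMeasure μ] [μ.IsOpenPosMeasure]
  {f : C(K, G)} {Λ : C(K, ℝ) →L[ℝ] ℝ}

/-- `p` is a continuous version of the conditional expectation of `u` given `f`, for the
functional `Λ` on `C(K)`: the density with respect to `μ` of the pushforward under `f` of `u Λ`. -/
def IsContinuousCondExp (μ : Measure G) (f : C(K, G)) (Λ : C(K, ℝ) →L[ℝ] ℝ)
    (u : C(K, ℝ)) (p : C(G, ℝ)) : Prop :=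
  ∀ h : C(G, ℝ), Λ (u * h.comp f) = ∫ x, p x * h x ∂μ

namespace IsContinuousCondExp

variable {u v : C(K, ℝ)} {p q : C(G, ℝ)}

omit [CompactSpace K] [μ.IsOpenPosMeasure] in
theorem add (hu : IsContinuousCondExp μ f Λ u p) (hv : IsContinuousCondExp μ f Λ v q) :
    IsContinuousCondExp μ f Λ (u + v) (p + q) := fun h ↦ by
  have h1 := integral_add (μ := μ) (p * h).integrable_of_compactSpace
    (q * h).integrable_of_compactSpace
  simp only [ContinuousMap.mul_apply] at h1
  simp only [add_mul, map_add, hu h, hv h, ContinuousMap.add_apply, h1]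

omit [CompactSpace K] [CompactSpace G] [BorelSpace G] [IsProbabilityMeasure μ] [μ.IsOpenPosMeasure] in
theorem smul (c : ℝ) (hu : IsContinuousCondExp μ f Λ u p) :
    IsContinuousCondExp μ f Λ (c • u) (c • p) := fun h ↦ by
  simp [hu h, mul_assoc, integral_const_mul]

theorem norm_le (hΛ : IsIntegralLift μ f Λ) (hu : IsContinuousCondExp μ f Λ u p) : ‖p‖ ≤ ‖u‖ :=
  ContinuousMap.norm_le_of_abs_integral_mul_le (μ := μ) (norm_nonneg u) fun h ↦ by
    rw [← hu h]
    exact hΛ.abs_apply_mul_comp_le u h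

theorem unique (hΛ : IsIntegralLift μ f Λ) (hp : IsContinuousCondExp μ f Λ u p)
    (hq : IsContinuousCondExp μ f Λ u q) : p = q := by
  have h := (hp.add (hq.smul (-1))).norm_le hΛ
  have h0 : u + (-1 : ℝ) • u = 0 := by simp
  rw [h0, norm_zero, norm_le_zero_iff] at h
  simpa [← sub_eq_add_neg, sub_eq_zero] using h

end IsContinuousCondExp

omit [CompactSpace G] [BorelSpace G] [IsProbabilityMeasure μ] [μ.IsOpenPosMeasure] in
theorem IsIntegralLift.isContinuousCondExp_comp (hΛ : IsIntegralLift μ f Λ) (h : C(G, ℝ)) :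
    IsContinuousCondExp μ f Λ (h.comp f) h := fun k ↦ hΛ.apply_comp (h * k)

/-- The subspace of functions that have a continuous conditional expectation. -/
def condExpDomain (μ : Measure G) [IsProbabilityMeasure μ] (f : C(K, G)) (Λ : C(K, ℝ) →L[ℝ] ℝ) :
    Submodule ℝ C(K, ℝ) where
  carrier := {u | ∃ p, IsContinuousCondExp μ f Λ u p}
  add_mem' := fun ⟨p, hp⟩ ⟨q, hq⟩ ↦ ⟨p + q, hp.add hq⟩
  zero_mem' := ⟨0, fun h ↦ by simp⟩
  smul_mem' := fun c _ ⟨p, hp⟩ ↦ ⟨c • p, hp.smul c⟩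

/-- If the functions with a continuous conditional expectation are dense, then conditional
expectation extends by contractivity to a bounded left inverse of `h ↦ h ∘ f`. -/
theorem IsIntegralLift.exists_leftInverse_comp (hΛ : IsIntegralLift μ f Λ)
    (hd : Dense (condExpDomain μ f Λ : Set C(K, ℝ))) :
    ∃ P : C(K, ℝ) →L[ℝ] C(G, ℝ), ∀ h : C(G, ℝ), P (h.comp f) = h := by
  let S := condExpDomain μ f Λ
  choose P₀ hP₀ using fun u : S ↦ u.2
  let PL : S →ₗ[ℝ] C(G, ℝ) :=
    { toFun := P₀
      map_add' := fun u v ↦ (hP₀ (u + v)).unique hΛ ((hP₀ u).add (hP₀ v))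
      map_smul' := fun c u ↦ (hP₀ (c • u)).unique hΛ ((hP₀ u).smul c) }
  have hdense : DenseRange S.subtype := by simpa [DenseRange] using! hd
  have hbound : ∀ u : S, ‖PL u‖ ≤ 1 * ‖S.subtype u‖ := fun u ↦ by
    simpa using! (hP₀ u).norm_le hΛ
  refine ⟨PL.extendOfNorm S.subtype, fun h ↦ ?_⟩
  have hS : h.comp f ∈ S := ⟨h, hΛ.isContinuousCondExp_comp h⟩
  have h1 := LinearMap.extendOfNorm_eq hdense ⟨1, hbound⟩ ⟨_, hS⟩
  exact h1.trans ((hP₀ ⟨_, hS⟩).unique hΛ (hΛ.isContinuousCondExp_comp h))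

end CondExp

/-! ### Functionals and dense subspaces on a product -/

section Product

variable {K₁ K₂ : Type*} [TopologicalSpace K₁] [CompactSpace K₁] [TopologicalSpace K₂]
  [CompactSpace K₂]

/-- The iterated functional `F ↦ Λ₂ (t₂ ↦ Λ₁ (t₁ ↦ F (t₁, t₂)))`, the product of the functionals
`Λ₁` and `Λ₂`. -/
noncomputable def iteratedFunctional (Λ₁ : C(K₁, ℝ) →L[ℝ] ℝ) (Λ₂ : C(K₂, ℝ) →L[ℝ] ℝ) :
    C(K₁ × K₂, ℝ) →L[ℝ] ℝ :=
  LinearMap.mkContinuous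
    { toFun := fun F ↦ Λ₂ ((⟨Λ₁, Λ₁.continuous⟩ : C(C(K₁, ℝ), ℝ)).comp
        (F.comp ContinuousMap.prodSwap).curry)
      map_add' := fun F F' ↦ by
        rw [← map_add]; congr 1; ext t
        exact map_add Λ₁ ((F.comp ContinuousMap.prodSwap).curry t)
          ((F'.comp ContinuousMap.prodSwap).curry t)
      map_smul' := fun c F ↦ by
        rw [← map_smul]; congr 1; ext t
        exact map_smul Λ₁ c ((F.comp ContinuousMap.prodSwap).curry t) }
    (‖Λ₂‖ * ‖Λ₁‖) fun F ↦ by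
      rw [mul_assoc]
      refine Λ₂.le_opNorm_of_le ((ContinuousMap.norm_le _ (by positivity)).2 fun t ↦
        Λ₁.le_opNorm_of_le ((ContinuousMap.norm_le _ (norm_nonneg _)).2 fun s ↦
          F.norm_coe_le_norm (s, t)))

theorem iteratedFunctional_apply {Λ₁ : C(K₁, ℝ) →L[ℝ] ℝ} {Λ₂ : C(K₂, ℝ) →L[ℝ] ℝ}
    {F : C(K₁ × K₂, ℝ)} {w : C(K₂, ℝ)}
    (hw : ∀ t, w t = Λ₁ ((F.comp ContinuousMap.prodSwap).curry t)) :
    iteratedFunctional Λ₁ Λ₂ F = Λ₂ w :=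
  congrArg Λ₂ (ContinuousMap.ext fun t ↦ (hw t).symm)

/-- By the Stone–Weierstrass theorem, the functions `(s, t) ↦ u s * v t` span a dense subspace. -/
theorem dense_of_tensor_mem [T2Space K₁] [T2Space K₂] (S : Submodule ℝ C(K₁ × K₂, ℝ))
    (hS : ∀ (u : C(K₁, ℝ)) (v : C(K₂, ℝ)),
      u.comp ContinuousMap.fst * v.comp ContinuousMap.snd ∈ S) :
    Dense (S : Set C(K₁ × K₂, ℝ)) := by
  let M : Submonoid C(K₁ × K₂, ℝ) :=
    { carrier := {F | ∃ (u : C(K₁, ℝ)) (v : C(K₂, ℝ)),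
        u.comp ContinuousMap.fst * v.comp ContinuousMap.snd = F}
      one_mem' := ⟨1, 1, by ext; simp⟩
      mul_mem' := by
        rintro _ _ ⟨u, v, rfl⟩ ⟨u', v', rfl⟩
        exact ⟨u * u', v * v', by ext; simp; ring⟩ }
  let A : Subalgebra ℝ C(K₁ × K₂, ℝ) := Algebra.adjoin ℝ (M : Set C(K₁ × K₂, ℝ))
  have hA : (A : Set C(K₁ × K₂, ℝ)) ⊆ S := by
    have : Subalgebra.toSubmodule A ≤ S := by
      rw [Algebra.adjoin_eq_span, Submonoid.closure_eq, Submodule.span_le]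
      rintro _ ⟨u, v, rfl⟩
      exact hS u v
    exact this
  have hsep : A.SeparatesPoints := by
    rintro ⟨s, t⟩ ⟨s', t'⟩ hne
    have hmem : ∀ (u : C(K₁, ℝ)) (v : C(K₂, ℝ)),
        u.comp ContinuousMap.fst * v.comp ContinuousMap.snd ∈ A := fun u v ↦
      Algebra.subset_adjoin ⟨u, v, rfl⟩
    by_cases hs : s = s'
    · have ht : t ≠ t' := fun h ↦ hne (by rw [hs, h])
      obtain ⟨v, hv, hvt⟩ := separatesPoints_continuous_of_t35Space ht
      exact ⟨_, ⟨_, hmem 1 ⟨v, hv⟩, rfl⟩, by simpa using hvt⟩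
    · obtain ⟨v, hv, hvt⟩ := separatesPoints_continuous_of_t35Space hs
      exact ⟨_, ⟨_, hmem ⟨v, hv⟩ 1, rfl⟩, by simpa using hvt⟩
  have htop := ContinuousMap.subalgebra_topologicalClosure_eq_top_of_separatesPoints A hsep
  have hdA : Dense (A : Set C(K₁ × K₂, ℝ)) := fun F ↦ by
    have : F ∈ A.topologicalClosure := htop ▸ Algebra.mem_top
    exact this
  exact hdA.mono hA

end Product

/-! ### Convolution of functionals with bounded density -/

section Convolution

variable {G : Type*} [Group G] [TopologicalSpace G] [IsTopologicalGroup G] [CompactSpace G]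

/-- The family of right translates `g ↦ (y ↦ b (y * g⁻¹))`. -/
def rightTranslates (b : C(G, ℝ)) : C(G, C(G, ℝ)) :=
  (b.comp ⟨fun q : G × G ↦ q.2 * q.1⁻¹, by fun_prop⟩).curry

/-- The family `y ↦ (x ↦ h (y⁻¹ * x))` of left translates. -/
def leftTranslates (h : C(G, ℝ)) : C(G, C(G, ℝ)) :=
  (h.comp ⟨fun q : G × G ↦ q.1⁻¹ * q.2, by fun_prop⟩).curry

omit [CompactSpace G] in
@[simp]
theorem rightTranslates_apply (b : C(G, ℝ)) (g y : G) :
    rightTranslates b g y = b (y * g⁻¹) := rfl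

omit [CompactSpace G] in
@[simp]
theorem leftTranslates_apply (h : C(G, ℝ)) (y x : G) :
    leftTranslates h y x = h (y⁻¹ * x) := rfl

/-- The function `g ↦ α (y ↦ b (y * g⁻¹))`, as a linear function of `b`. When `α` is integration
against a density `a`, this is `g ↦ ∫ a (y * g) b y`. -/
def convFunctional (α : C(G, ℝ) →L[ℝ] ℝ) : C(G, ℝ) →ₗ[ℝ] C(G, ℝ) where
  toFun b := (⟨α, α.continuous⟩ : C(C(G, ℝ), ℝ)).comp (rightTranslates b)
  map_add' b c := by ext g; exact map_add α (rightTranslates b g) (rightTranslates c g)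
  map_smul' r b := by ext g; exact map_smul α r (rightTranslates b g)

omit [CompactSpace G] in
theorem convFunctional_apply (α : C(G, ℝ) →L[ℝ] ℝ) (b : C(G, ℝ)) (g : G) :
    convFunctional α b g = α (rightTranslates b g) := rfl

variable [MeasurableSpace G] [BorelSpace G] (μ : Measure G) [μ.IsHaarMeasure]
  [IsProbabilityMeasure μ]

omit [Group G] [IsTopologicalGroup G] [μ.IsHaarMeasure] in
theorem integrable_smul_family (b : C(G, ℝ)) (F : C(G, C(G, ℝ))) :
    Integrable (fun y ↦ b y • F y) μ :=
  ContinuousMap.integrable_of_compactSpace ⟨fun y ↦ b y • F y, b.continuous.smul F.continuous⟩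

/-- An identity of Bochner integrals in `C(G)`, by the substitution `y = x * g⁻¹` at each point
`x`. It takes the place of Fubini's theorem, which is not available for Borel functions on `G × G`
when `G` is not second countable. -/
theorem integral_smul_rightTranslates (b h : C(G, ℝ)) :
    ∫ g, h g • rightTranslates b g ∂μ = ∫ y, b y • leftTranslates h y ∂μ := by
  have := isInvInvariant_of_compactSpace μ
  have hr := integrable_smul_family μ h (rightTranslates b)
  have hl := integrable_smul_family μ b (leftTranslates h)
  ext x
  rw [← ContinuousMap.evalCLM_apply ℝ, ← ContinuousMap.evalCLM_apply ℝ,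
    ← ContinuousLinearMap.integral_comp_comm _ hr, ← ContinuousLinearMap.integral_comp_comm _ hl]
  refine Eq.trans ?_ (integral_div_left_eq_self _ μ x)
  simp [div_eq_mul_inv, mul_comm (h _)]

/-- Applying `α` to both sides of `integral_smul_rightTranslates`. -/
theorem integral_convFunctional_mul (α : C(G, ℝ) →L[ℝ] ℝ) (b h : C(G, ℝ)) :
    ∫ g, convFunctional α b g * h g ∂μ = ∫ y, α (leftTranslates h y) * b y ∂μ := by
  have hr := integrable_smul_family μ h (rightTranslates b)
  have hl := integrable_smul_family μ b (leftTranslates h)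
  have key := congrArg α (integral_smul_rightTranslates μ b h)
  rw [← α.integral_comp_comm hr, ← α.integral_comp_comm hl] at key
  simpa [convFunctional_apply, mul_comm] using key

/-- The supremum norm of the convolution is controlled by the `L²` norm of `b`, which is what lets
`b` be replaced by an arbitrary `L²` function without losing continuity. -/
theorem norm_convFunctional_le {α : C(G, ℝ) →L[ℝ] ℝ} {A : ℝ} (hA : 0 ≤ A)
    (hα : ∀ k : C(G, ℝ), |α k| ≤ A * ∫ x, |k x| ∂μ) (b : C(G, ℝ)) :
    ‖convFunctional α b‖ ≤ A * ‖ContinuousMap.toLp 2 μ ℝ b‖ := by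
  have := isMulRightInvariant_of_compactSpace μ
  refine (ContinuousMap.norm_le _ (by positivity)).2 fun g ↦ ?_
  refine (hα (rightTranslates b g)).trans (mul_le_mul_of_nonneg_left ?_ hA)
  simp only [rightTranslates_apply]
  rw [integral_mul_right_eq_self (fun y ↦ |b y|) g⁻¹]
  exact b.integral_abs_le_norm_toLp

/-- The convolution of two functionals that are bounded for the `L¹` norm is given by a continuous
density `p`; when `α` and `β` have densities `a` and `b`, it is `p g = ∫ a (y * g) b y`. -/
theorem exists_convolution {α β : C(G, ℝ) →L[ℝ] ℝ} {A B : ℝ} (hA : 0 ≤ A)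
    (hα : ∀ k : C(G, ℝ), |α k| ≤ A * ∫ x, |k x| ∂μ) (hB : 0 ≤ B)
    (hβ : ∀ k : C(G, ℝ), |β k| ≤ B * ∫ x, |k x| ∂μ) :
    ∃ p : C(G, ℝ), ∀ h : C(G, ℝ), ∫ g, p g * h g ∂μ =
      β ((⟨α, α.continuous⟩ : C(C(G, ℝ), ℝ)).comp (leftTranslates h)) := by
  let ι : C(G, ℝ) →L[ℝ] Lp ℝ 2 μ := ContinuousMap.toLp 2 μ ℝ
  have hd : DenseRange ι := ContinuousMap.toLp_denseRange ℝ μ ℝ (by simp)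
  have hQ := norm_convFunctional_le μ hA hα
  have hβ' : ∀ k, ‖β.toLinearMap k‖ ≤ B * ‖ι k‖ := fun k ↦
    (hβ k).trans (mul_le_mul_of_nonneg_left k.integral_abs_le_norm_toLp hB)
  let Q : Lp ℝ 2 μ →L[ℝ] C(G, ℝ) := (convFunctional α).extendOfNorm ι.toLinearMap
  let β₂ : Lp ℝ 2 μ →L[ℝ] ℝ := β.toLinearMap.extendOfNorm ι.toLinearMap
  have hQι : ∀ b, Q (ι b) = convFunctional α b :=
    LinearMap.extendOfNorm_eq (e := ι.toLinearMap) hd ⟨A, hQ⟩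
  have hβι : ∀ b, β₂ (ι b) = β b :=
    LinearMap.extendOfNorm_eq (e := ι.toLinearMap) hd ⟨B, hβ'⟩
  -- The Riesz representation of `β` on `L²`.
  let b : Lp ℝ 2 μ := (InnerProductSpace.toDual ℝ (Lp ℝ 2 μ)).symm β₂
  refine ⟨Q b, fun h ↦ ?_⟩
  let H : C(G, ℝ) := (⟨α, α.continuous⟩ : C(C(G, ℝ), ℝ)).comp (leftTranslates h)
  have key : ∀ x : Lp ℝ 2 μ, ⟪ι h, ι (Q x)⟫_ℝ = ⟪x, ι H⟫_ℝ := by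
    refine fun x ↦ hd.induction (P := fun x ↦ ⟪ι h, ι (Q x)⟫_ℝ = ⟪x, ι H⟫_ℝ) ?_
      (isClosed_eq (by fun_prop) (by fun_prop)) x
    rintro _ ⟨c, rfl⟩
    rw [hQι, ContinuousMap.inner_toLp, ContinuousMap.inner_toLp]
    exact integral_convFunctional_mul μ α c h
  calc ∫ g, Q b g * h g ∂μ = ⟪ι h, ι (Q b)⟫_ℝ := (ContinuousMap.inner_toLp μ h (Q b)).symm
    _ = ⟪b, ι H⟫_ℝ := key b
    _ = β H := by rw [InnerProductSpace.toDual_symm_apply, hβι]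

end Convolution

/-! ### The map `(t₁, t₂) ↦ f₂(t₂)⁻¹ f₁(t₁)` -/

section LeftQuotient

variable {K₁ K₂ G : Type*} [TopologicalSpace K₁] [CompactSpace K₁] [TopologicalSpace K₂]
  [CompactSpace K₂] [Group G] [TopologicalSpace G] [IsTopologicalGroup G] [CompactSpace G]

/-- The map `(t₁, t₂) ↦ f₂(t₂)⁻¹ f₁(t₁)`. -/
def leftQuotient (f₁ : C(K₁, G)) (f₂ : C(K₂, G)) : C(K₁ × K₂, G) :=
  ⟨fun t ↦ (f₂ t.2)⁻¹ * f₁ t.1, by fun_prop⟩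

/-- The functional `k ↦ Λ (u * (k ∘ f))`, the pushforward of `u Λ` under `f`. -/
noncomputable def pushforwardFunctional {K : Type*} [TopologicalSpace K] [CompactSpace K]
    (f : C(K, G)) (Λ : C(K, ℝ) →L[ℝ] ℝ) (u : C(K, ℝ)) : C(G, ℝ) →L[ℝ] ℝ where
  toFun k := Λ (u * k.comp f)
  map_add' k l := by rw [← map_add, ← mul_add]; rfl
  map_smul' c k := by rw [← map_smul, ← mul_smul_comm]; rfl
  cont := by
    have := ContinuousMap.continuous_precomp (Z := ℝ) f
    fun_prop

variable [MeasurableSpace G] [BorelSpace G] {μ : Measure G} [μ.IsHaarMeasure]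
  [IsProbabilityMeasure μ] {f₁ : C(K₁, G)} {f₂ : C(K₂, G)} {Λ₁ : C(K₁, ℝ) →L[ℝ] ℝ}
  {Λ₂ : C(K₂, ℝ) →L[ℝ] ℝ}

omit [CompactSpace G] in
/-- By left invariance of `μ`, already the inner functional sends `h ∘ leftQuotient f₁ f₂` to the
constant `∫ h ∂μ`. -/
theorem IsIntegralLift.iteratedFunctional (h₁ : IsIntegralLift μ f₁ Λ₁)
    (h₂ : IsIntegralLift μ f₂ Λ₂) :
    IsIntegralLift μ (leftQuotient f₁ f₂) (iteratedFunctional Λ₁ Λ₂) where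
  norm_apply_le F := by
    refine (h₂.norm_apply_le _).trans ((ContinuousMap.norm_le _ (norm_nonneg _)).2 fun t ↦
      (h₁.norm_apply_le _).trans ((ContinuousMap.norm_le _ (norm_nonneg _)).2 fun s ↦
        F.norm_coe_le_norm (s, t)))
  apply_comp h := by
    rw [iteratedFunctional_apply (w := (∫ x, h x ∂μ) • 1), map_smul, h₂.apply_one, smul_eq_mul,
      mul_one]
    intro t
    have := h₁.apply_comp (leftTranslates h (f₂ t))
    simp only [leftTranslates_apply] at this
    rw [integral_mul_left_eq_self] at this
    rw [← this]
    simp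
    rfl

/-- The continuous conditional expectation of `u ⊗ v` is the convolution of the pushforwards of
`u Λ₁` and `v Λ₂` to `G`. -/
theorem exists_isContinuousCondExp_tensor (h₁ : IsIntegralLift μ f₁ Λ₁)
    (h₂ : IsIntegralLift μ f₂ Λ₂) (u : C(K₁, ℝ)) (v : C(K₂, ℝ)) :
    ∃ p, IsContinuousCondExp μ (leftQuotient f₁ f₂) (iteratedFunctional Λ₁ Λ₂)
      (u.comp ContinuousMap.fst * v.comp ContinuousMap.snd) p := by
  obtain ⟨p, hp⟩ := exists_convolution μ (α := pushforwardFunctional f₁ Λ₁ u)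
    (β := pushforwardFunctional f₂ Λ₂ v) (norm_nonneg u) (h₁.abs_apply_mul_comp_le u)
    (norm_nonneg v) (h₂.abs_apply_mul_comp_le v)
  refine ⟨p, fun h ↦ ?_⟩
  rw [hp h]
  refine iteratedFunctional_apply fun t ↦ ?_
  refine (map_smul Λ₁ (v t) (u * (leftTranslates h (f₂ t)).comp f₁)).symm.trans
    (congrArg Λ₁ (ContinuousMap.ext fun s ↦ ?_))
  simp [leftQuotient]
  ring

end LeftQuotient

/-! ### The complemented copy of `C(G)` -/

theorem theorem1p1 {K₁ K₂ G : Type*}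
    [TopologicalSpace K₁] [CompactSpace K₁] [T2Space K₁]
    [TopologicalSpace K₂] [CompactSpace K₂] [T2Space K₂]
    [Group G] [TopologicalSpace G] [IsTopologicalGroup G] [CompactSpace G] [T2Space G]
    (f₁ : K₁ → G) (f₂ : K₂ → G)
    (hf₁ : Continuous f₁) (hf₁_surj : Function.Surjective f₁)
    (hf₂ : Continuous f₂) (hf₂_surj : Function.Surjective f₂) :
    ∃ E : Submodule ℝ C(K₁ × K₂, ℝ), E.ClosedComplemented ∧
      ∃ T : C(G, ℝ) ≃ₗᵢ[ℝ] E,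
        ∀ (h : C(G, ℝ)) (t₁ : K₁) (t₂ : K₂),
          (T h : C(K₁ × K₂, ℝ)) (t₁, t₂) = h ((f₂ t₂)⁻¹ * f₁ t₁) := by
  borelize G
  let μ : Measure G := haarMeasure ⊤
  have : IsProbabilityMeasure μ := ⟨haarMeasure_self⟩
  let φ₁ : C(K₁, G) := ⟨f₁, hf₁⟩
  let φ₂ : C(K₂, G) := ⟨f₂, hf₂⟩
  obtain ⟨Λ₁, h₁⟩ := exists_isIntegralLift μ φ₁ hf₁_surj
  obtain ⟨Λ₂, h₂⟩ := exists_isIntegralLift μ φ₂ hf₂_surj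
  have hρ : Function.Surjective (leftQuotient φ₁ φ₂) := fun g ↦ by
    obtain ⟨t₂, ht₂⟩ := hf₂_surj 1
    obtain ⟨t₁, ht₁⟩ := hf₁_surj g
    exact ⟨(t₁, t₂), by simp [leftQuotient, φ₁, φ₂, ht₁, ht₂]⟩
  obtain ⟨P, hP⟩ := (h₁.iteratedFunctional h₂).exists_leftInverse_comp
    (dense_of_tensor_mem _ (exists_isContinuousCondExp_tensor h₁ h₂))
  let J := ContinuousMap.compSurjective (leftQuotient φ₁ φ₂) hρ
  refine ⟨LinearMap.range J.toLinearMap,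
    ⟨J.equivRange.toContinuousLinearEquiv.toContinuousLinearMap.comp P, ?_⟩,
    J.equivRange, fun h t₁ t₂ ↦ rfl⟩
  rintro ⟨_, h, rfl⟩
  exact congrArg J.equivRange (hP h)
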